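/- Let $K$ be a field, let $n\ge 3$ and $k\ge 1$ be integers, and let $S=K[x_1,\dots,x_n]$. Let $C_n$ be the cycle on the vertices $1,\dots,n$, and let $C_n^k$ be its $k$-th power, that is, the graph on the same vertices in which two distinct vertices are adjacent if and only if their distance in $C_n$ is at most $k$. Let $I(C_n^k)=(x_ix_j : \{i,j\}\in E(C_n^k))\subset S$ be its edge ideal. For a monomial ideal $I\subset S$, a Stanley decomposition of $S/I$ is a presentation of the $K$-vector space $S/I$ as a finite direct sum $\mathcal D:\ S/I=\bigoplus_{i=1}^{s} v_iK[W_i]$, where each $v_i\in S/I$ is homogeneous for the $\mathbb Z^n$-grading (the class of a scalar multiple of a monomial), $W_i\subseteq\{x_1,\dots,x_n\}$, $v_iK[W_i]$ is the $K$-subspace spanned by all $v_iw$ with $w$ a monomial in $K[W_i]$, and $v_iK[W_i]$ is a free $K[W_i]$-module with basis $v_i$. Put $\operatorname{sdepth}(\mathcal D)=\min_i |W_i|$, and let $\operatorname{sdepth}(S/I)$ be the maximum of $\operatorname{sdepth}(\mathcal D)$ over all Stanley decompositions $\mathcal D$ of $S/I$. Then: 1. if $n\le 2k+1$, then $\operatorname{sdepth}(S/I(C_n^k))=1$;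 2. if $n\ge 2k+2$ and $n$ is congruent to one of $0,k+1,k+2,\dots,2k$ modulo $2k+1$, then $\operatorname{sdepth}(S/I(C_n^k))=\left\lceil\frac{n}{2k+1}\right\rceil$; 3. if $n\ge 2k+2$ and $n$ is congruent to one of $1,\dots,k$ modulo $2k+1$, then $\left\lceil\frac{n}{2k+1}\right\rceil-1\le \operatorname{sdepth}(S/I(C_n^k))\le\left\lceil\frac{n}{2k+1}\right\rceil$. -/

import Mathlib

/-- The `k`-th power of a simple graph `G`: the graph on the same vertex set in which two distinct
vertices are adjacent when their distance in `G` is at most `k` (`edist` is the graph distance, with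
value `⊤` for vertices in different components). -/
def SimpleGraph.kthPower {V : Type*} (G : SimpleGraph V) (k : ℕ) : SimpleGraph V where
  Adj u v := u ≠ v ∧ G.edist u v ≤ (k : ℕ∞)
  symm := ⟨fun _ _ h => ⟨h.1.symm, by rw [SimpleGraph.edist_comm]; exact h.2⟩⟩
  loopless := ⟨fun _ h => h.1 rfl⟩

/-- The edge ideal of a graph `G` on the vertices `0, …, n - 1`: the ideal of `K[x_0, …, x_{n-1}]`
generated by the products `x_i x_j` over the edges `{i, j}` of `G`. -/
noncomputable def edgeIdeal (K : Type*) [Field K] {n : ℕ} (G : SimpleGraph (Fin n)) :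
    Ideal (MvPolynomial (Fin n) K) :=
  Ideal.span {p | ∃ i j : Fin n, G.Adj i j ∧ p = MvPolynomial.X i * MvPolynomial.X j}

section StanleyDepth

variable {K : Type*} [Field K] {n : ℕ}

/-- For `v ∈ S/I` and a set `W` of variables, `v K[W]` is the `K`-subspace of `S/I` spanned by all
elements `v w`, where `w` is a monomial in the variables in `W`. -/
noncomputable def stanleySubspace (I : Ideal (MvPolynomial (Fin n) K)) (v : MvPolynomial (Fin n) K ⧸ I)
    (W : Finset (Fin n)) : Submodule K (MvPolynomial (Fin n) K ⧸ I) :=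
  Submodule.span K {y | ∃ a : Fin n →₀ ℕ, a.support ⊆ W ∧
    y = (MvPolynomial.monomial a (1 : K)) • v}

/-- An element of `S/I` is homogeneous for the fine (`ℤⁿ`-)grading when it is the class of a
scalar multiple of a monomial. (Used for monomial ideals `I`, for which `S/I` inherits the fine
grading of `S`.) -/
def IsFinelyHomogeneous (I : Ideal (MvPolynomial (Fin n) K))
    (v : MvPolynomial (Fin n) K ⧸ I) : Prop :=
  ∃ (a : Fin n →₀ ℕ) (c : K), v = Ideal.Quotient.mk I (MvPolynomial.monomial a c)

/-- A Stanley decomposition of `S/I`: finitely many homogeneous elements `v i` and sets of variables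
`W i`, such that each `v i K[W i]` is a free `K[W i]`-module with basis `v i`, and `S/I` is the
(internal) direct sum of the subspaces `v i K[W i]`. -/
structure StanleyDecomposition (I : Ideal (MvPolynomial (Fin n) K)) where
  /-- the number of summands -/
  s : ℕ
  /-- the generators of the summands -/
  v : Fin s → MvPolynomial (Fin n) K ⧸ I
  /-- the sets of variables of the summands -/
  W : Fin s → Finset (Fin n)
  homogeneous : ∀ i, IsFinelyHomogeneous I (v i)
  free : ∀ i, ∀ p ∈ MvPolynomial.supported K (W i : Set (Fin n)), p • v i = 0 → p = 0
  isInternal : DirectSum.IsInternal fun i => stanleySubspace I (v i) (W i)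

/-- The Stanley depth of a Stanley decomposition: the least cardinality of the sets `W i`. -/
noncomputable def StanleyDecomposition.sdepth {I : Ideal (MvPolynomial (Fin n) K)}
    (D : StanleyDecomposition I) : ℕ :=
  ⨅ i : Fin D.s, (D.W i).card

/-- The Stanley depth of `S/I`: the maximum of the Stanley depths of its Stanley decompositions. -/
noncomputable def stanleyDepth (I : Ideal (MvPolynomial (Fin n) K)) : ℕ :=
  sSup {d | ∃ D : StanleyDecomposition I, D.sdepth = d}

/-- The Stanley depths of decompositions are bounded by the number of variables, so that the
supremum in `stanleyDepth` is a maximum as soon as there is a Stanley decomposition. -/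
theorem StanleyDecomposition.sdepth_le {I : Ideal (MvPolynomial (Fin n) K)}
    (D : StanleyDecomposition I) : D.sdepth ≤ n := by
  unfold StanleyDecomposition.sdepth
  rcases isEmpty_or_nonempty (Fin D.s) with h | ⟨⟨i⟩⟩
  · simp
  · exact (ciInf_le (OrderBot.bddBelow _) i).trans
      ((Finset.card_le_univ _).trans (by simp))

end StanleyDepth

open Finset

/-! The monomials outside the edge ideal are those with independent support, and their classes form
a basis of the quotient. Both bounds are therefore combinatorics of independent sets.

Lower bound: for independent `T`, the monomials of `x_F K[T]` are exactly those whose support lies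
in the interval `[F, T]`. A partition of the independent sets into intervals with large tops thus
gives a Stanley decomposition (`exists_stanleyDecomposition`). Partitions are built by splitting on
a vertex (`of_deletion`) and by products over non-adjacent pieces (`union`). This yields
`⌈m/(2k+1)⌉` for the `k`-th power of a path on `m` vertices. Deleting `k` consecutive vertices turns
the cycle into such a path with `m = n - k`, whence `⌈(n-k)/(2k+1)⌉`.

Upper bound: the summand containing `x_F`, for a maximal independent `F`, has all its variables in
`F`, so the depth is at most `#F`. Vertices spaced `2k+1` apart, with the last one adjusted, give
such an `F` with at most `⌈n/(2k+1)⌉` elements.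

The two ceilings agree when `n` is `0` or at least `k+1` modulo `2k+1`, and differ by one otherwise.
-/

/-- The independent subsets of `A` are partitioned into intervals `[F, T]` with `d ≤ #T`. -/
def HasIntervalPartition {V : Type*} (G : SimpleGraph V) (A : Finset V) (d : ℕ) : Prop :=
  ∃ P : Finset (Finset V × Finset V),
    (∀ p ∈ P, p.1 ⊆ p.2 ∧ p.2 ⊆ A ∧ G.IsIndepSet (p.2 : Set V) ∧ d ≤ #p.2) ∧
    ∀ F ⊆ A, G.IsIndepSet (F : Set V) → ∃! p, p ∈ P ∧ p.1 ⊆ F ∧ F ⊆ p.2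

/-! ### Constructions of interval partitions -/

namespace HasIntervalPartition

variable {V : Type*} {G : SimpleGraph V} {A B : Finset V} {d e : ℕ}

theorem mono (h : HasIntervalPartition G A d) (hed : e ≤ d) : HasIntervalPartition G A e := by
  obtain ⟨P, h1, h2⟩ := h
  exact ⟨P, fun p hp => ⟨(h1 p hp).1, (h1 p hp).2.1, (h1 p hp).2.2.1, hed.trans (h1 p hp).2.2.2⟩, h2⟩

theorem zero (G : SimpleGraph V) (A : Finset V) : HasIntervalPartition G A 0 := by
  classical
  refine ⟨(A.powerset.filter fun F : Finset V => G.IsIndepSet (F : Set V)).image fun F => (F, F), ?_, ?_⟩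
  · simp only [mem_image, mem_filter, mem_powerset]
    rintro _ ⟨F, ⟨h1, h2⟩, rfl⟩
    exact ⟨subset_rfl, h1, h2, Nat.zero_le _⟩
  · intro F hF hi
    refine ⟨(F, F), ⟨?_, subset_rfl, subset_rfl⟩, ?_⟩
    · simp only [mem_image, mem_filter, mem_powerset]
      exact ⟨F, ⟨hF, hi⟩, rfl⟩
    · simp only [mem_image, mem_filter, mem_powerset]
      rintro _ ⟨⟨F', _, rfl⟩, h1, h2⟩
      obtain rfl : F' = F := subset_antisymm h1 h2
      rfl

variable [DecidableEq V]

/-- Independent sets avoiding `v` are those of the deletion of `v`; those containing `v` come from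
the deletion `B` of the closed neighbourhood of `v`. -/
theorem of_deletion {v : V} (hv : v ∈ A) (hB : ∀ w, w ∈ B ↔ w ∈ A ∧ w ≠ v ∧ ¬ G.Adj v w)
    (h1 : HasIntervalPartition G (A.erase v) (d + 1)) (h2 : HasIntervalPartition G B d) :
    HasIntervalPartition G A (d + 1) := by
  obtain ⟨P, hP, hP'⟩ := h1
  obtain ⟨Q, hQ, hQ'⟩ := h2
  have hvB : v ∉ B := fun h => ((hB v).1 h).2.1 rfl
  refine ⟨P ∪ Q.image fun q => (insert v q.1, insert v q.2), ?_, ?_⟩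
  · intro p hp
    rcases mem_union.1 hp with hp | hp
    · obtain ⟨a, b, c⟩ := hP p hp
      exact ⟨a, b.trans (erase_subset _ _), c⟩
    · obtain ⟨q, hq, rfl⟩ := mem_image.1 hp
      obtain ⟨a, b, c, e⟩ := hQ q hq
      refine ⟨insert_subset_insert _ a, insert_subset hv fun w hw => ((hB w).1 (b hw)).1, ?_, ?_⟩
      · rw [coe_insert, SimpleGraph.IsIndepSet, Set.pairwise_insert]
        refine ⟨c, fun w hw _ => ?_⟩
        have := ((hB w).1 (b hw)).2.2
        exact ⟨this, fun h => this h.symm⟩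
      · rw [card_insert_of_notMem fun h => hvB (b h)]
        simp [e]
  · intro F hF hi
    by_cases hvF : v ∈ F
    · have hFB : F.erase v ⊆ B := fun w hw => (hB w).2
        ⟨hF (mem_of_mem_erase hw), ne_of_mem_erase hw,
          hi hvF (mem_of_mem_erase hw) (ne_of_mem_erase hw).symm⟩
      obtain ⟨q, ⟨hq, hq1, hq2⟩, hu⟩ := hQ' _ hFB
        (hi.mono (by simp))
      refine ⟨(insert v q.1, insert v q.2), ⟨?_, ?_, ?_⟩, ?_⟩
      · exact mem_union_right _ (mem_image_of_mem _ hq)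
      · exact insert_subset hvF (hq1.trans (erase_subset _ _))
      · exact subset_insert_iff.2 hq2
      · rintro p ⟨hp, hp1, hp2⟩
        rcases mem_union.1 hp with hp | hp
        · exact absurd rfl (ne_of_mem_erase ((hP p hp).2.1 (hp2 hvF)))
        · obtain ⟨q', hq', rfl⟩ := mem_image.1 hp
          rw [hu q' ⟨hq', ?_, ?_⟩]
          · exact fun w hw => mem_erase.2 ⟨fun h => hvB ((hQ q' hq').2.1
              ((hQ q' hq').1 (h ▸ hw))), hp1 (mem_insert_of_mem hw)⟩
          · exact subset_insert_iff.1 hp2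
    · obtain ⟨p, ⟨hp, hp1, hp2⟩, hu⟩ := hP' F (subset_erase.2 ⟨hF, hvF⟩) hi
      refine ⟨p, ⟨mem_union_left _ hp, hp1, hp2⟩, ?_⟩
      rintro p' ⟨hp', h1, h2⟩
      rcases mem_union.1 hp' with hp' | hp'
      · exact hu _ ⟨hp', h1, h2⟩
      · obtain ⟨q, hq, rfl⟩ := mem_image.1 hp'
        exact absurd (h1 (mem_insert_self _ _)) hvF

/-- Without edges between the pieces, independent sets of the union are pairs of independent sets,
and products of intervals are intervals whose top sizes add. -/
theorem union (hAB : Disjoint A B) (hadj : ∀ a ∈ A, ∀ b ∈ B, ¬ G.Adj a b)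
    (h1 : HasIntervalPartition G A d) (h2 : HasIntervalPartition G B e) :
    HasIntervalPartition G (A ∪ B) (d + e) := by
  obtain ⟨P, hP, hP'⟩ := h1
  obtain ⟨Q, hQ, hQ'⟩ := h2
  refine ⟨(P ×ˢ Q).image fun r => (r.1.1 ∪ r.2.1, r.1.2 ∪ r.2.2), ?_, ?_⟩
  · intro r hr
    obtain ⟨⟨p, q⟩, hpq, rfl⟩ := mem_image.1 hr
    obtain ⟨hp, hq⟩ := mem_product.1 hpq
    obtain ⟨a, b, c, f⟩ := hP p hp
    obtain ⟨a', b', c', f'⟩ := hQ q hq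
    refine ⟨union_subset_union a a', union_subset_union b b', ?_, ?_⟩
    · rw [coe_union, SimpleGraph.IsIndepSet, Set.pairwise_union]
      refine ⟨c, c', fun x hx y hy _ => ?_⟩
      have := hadj x (b hx) y (b' hy)
      exact ⟨this, fun h => this h.symm⟩
    · rw [card_union_of_disjoint (disjoint_of_subset_left b (disjoint_of_subset_right b' hAB))]
      exact add_le_add f f'
  · intro F hF hi
    obtain ⟨p, ⟨hp, hp1, hp2⟩, hpu⟩ := hP' (F ∩ A) inter_subset_right
      (hi.mono (by exact_mod_cast inter_subset_left))
    obtain ⟨q, ⟨hq, hq1, hq2⟩, hqu⟩ := hQ' (F ∩ B) inter_subset_right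
      (hi.mono (by exact_mod_cast inter_subset_left))
    refine ⟨(p.1 ∪ q.1, p.2 ∪ q.2), ⟨?_, ?_, ?_⟩, ?_⟩
    · exact mem_image.2 ⟨(p, q), mem_product.2 ⟨hp, hq⟩, rfl⟩
    · exact union_subset (hp1.trans inter_subset_left) (hq1.trans inter_subset_left)
    · intro x hx
      rcases mem_union.1 (hF hx) with h | h
      · exact mem_union_left _ (hp2 (mem_inter.2 ⟨hx, h⟩))
      · exact mem_union_right _ (hq2 (mem_inter.2 ⟨hx, h⟩))
    · rintro r ⟨hr, hr1, hr2⟩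
      obtain ⟨⟨p', q'⟩, hpq, rfl⟩ := mem_image.1 hr
      obtain ⟨hp', hq'⟩ := mem_product.1 hpq
      obtain ⟨a, b, -, -⟩ := hP p' hp'
      obtain ⟨a', b', -, -⟩ := hQ q' hq'
      have e1 := hpu p' ⟨hp', subset_inter (subset_union_left.trans hr1) (a.trans b),
        fun x hx => (mem_union.1 (hr2 (mem_inter.1 hx).1)).resolve_right fun h =>
          disjoint_left.1 hAB (mem_inter.1 hx).2 (b' h)⟩
      have e2 := hqu q' ⟨hq', subset_inter (subset_union_right.trans hr1) (a'.trans b'),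
        fun x hx => (mem_union.1 (hr2 (mem_inter.1 hx).1)).resolve_left fun h =>
          disjoint_left.1 hAB (b h) (mem_inter.1 hx).2⟩
      rw [e1, e2]

/-- Vertices are split off one at a time; the sets containing the chosen vertex already have size at
least 1, so the trivial partition serves for them. -/
theorem one (G : SimpleGraph V) (hA : A.Nonempty) : HasIntervalPartition G A 1 := by
  classical
  induction hA using Finset.Nonempty.cons_induction with
  | singleton v =>
    refine ⟨{(∅, {v})}, ?_, ?_⟩
    · simp
    · intro F hF _
      exact ⟨(∅, {v}), ⟨mem_singleton_self _, empty_subset _, hF⟩, fun p hp => mem_singleton.1 hp.1⟩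
  | cons v s hv hs ih =>
    refine of_deletion (d := 0) (v := v) (mem_cons_self v s)
      (B := (cons v s hv).filter fun w => w ≠ v ∧ ¬ G.Adj v w) (by simp) ?_ (zero _ _)
    simpa [erase_insert hv] using ih

end HasIntervalPartition

/-! ### Lower bounds for powers of paths and cycles -/

variable {n : ℕ}

/-- The vertices `i` with `a ≤ i < b`. -/
def vertexRun (n a b : ℕ) : Finset (Fin n) := univ.filter fun i => a ≤ i.1 ∧ i.1 < b

@[simp] theorem mem_vertexRun {a b : ℕ} {i : Fin n} :
    i ∈ vertexRun n a b ↔ a ≤ i.1 ∧ i.1 < b := by simp [vertexRun]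

/-- Interval partitions for powers of paths. -/
theorem hasIntervalPartition_vertexRun {G : SimpleGraph (Fin n)} {k : ℕ} (hk : 1 ≤ k) (a b : ℕ)
    (hb : b ≤ n) (hG : ∀ i j : Fin n, a ≤ i.1 → i < j → j.1 < b → (G.Adj i j ↔ j.1 ≤ i.1 + k)) :
    HasIntervalPartition G (vertexRun n a b) ((b - a + 2 * k) / (2 * k + 1)) := by
  induction hm : b - a using Nat.strong_induction_on generalizing a b with
  | _ m ih =>
  subst hm
  have hD : 0 < 2 * k + 1 := by omega
  -- The target `(b - a + 2k)/(2k+1)` is the ceiling of `(b - a)/(2k+1)`, hence at most 1 for short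
  -- runs.
  rcases Nat.lt_or_ge (b - a) (2 * k + 2) with h | h
  · rcases Nat.eq_zero_or_pos (b - a) with h0 | h0
    · rw [h0, Nat.div_eq_of_lt (by omega)]
      exact .zero _ _
    · refine HasIntervalPartition.mono (.one G ⟨⟨a, by omega⟩, by simp; omega⟩) ?_
      exact Nat.lt_succ_iff.1 ((Nat.div_lt_iff_lt_mul hD).2 (by omega))
  have hG' : ∀ i j : Fin n, a ≤ i.1 → i.1 < b → a ≤ j.1 → j.1 < b → i ≠ j →
      (G.Adj i j ↔ j.1 ≤ i.1 + k ∧ i.1 ≤ j.1 + k) := by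
    intro i j h1 h2 h3 h4 hne
    rcases lt_or_gt_of_ne hne with h | h
    · rw [hG i j h1 h h4]; have : i.1 < j.1 := h; omega
    · rw [G.adj_comm, hG j i h3 h h2]; have : j.1 < i.1 := h; omega
  have hsub : ∀ a' b' : ℕ, a ≤ a' → b' ≤ b → b' - a' < b - a →
      HasIntervalPartition G (vertexRun n a' b') ((b' - a' + 2 * k) / (2 * k + 1)) :=
    fun a' b' h1 h2 h3 => ih _ h3 a' b' (h2.trans hb)
      (fun i j hi hij hj => hG i j (h1.trans hi) hij (hj.trans_le h2)) rfl
  -- The gap makes the two runs non-adjacent: the first contributes 1, the second its inductive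
  -- bound.
  have hsplit : ∀ c c' : ℕ, a < c → c + k ≤ c' → c' ≤ b → a + 2 * k + 1 ≤ c' →
      c' ≤ a + 4 * k + 2 →
      HasIntervalPartition G (vertexRun n a c ∪ vertexRun n c' b)
        (1 + (b - c' + 2 * k) / (2 * k + 1)) := by
    intro c c' h1 h2 h3 h4 h5
    refine .union ?_ ?_ (.one G ⟨⟨a, by omega⟩, by simp; omega⟩) (hsub c' b (by omega) le_rfl (by omega))
    · rw [disjoint_left]; intro i; simp; omega
    · intro i hi j hj
      simp only [mem_vertexRun] at hi hj
      rw [hG' i j (by omega) (by omega) (by omega) (by omega) (by intro h; subst h; omega)]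
      omega
  obtain ⟨d, hd⟩ : ∃ d, d = (b - a - (2 * k + 1) + 2 * k) / (2 * k + 1) := ⟨_, rfl⟩
  have hd' : (b - a + 2 * k) / (2 * k + 1) = d + 1 := by
    rw [hd, ← Nat.add_div_right _ hD]; congr 1; omega
  rw [hd']
  -- The vertices `a+k, …, a+2k` are deleted in turn; `j` are gone and `t` remain. Once all are
  -- gone, the run has split into two non-adjacent pieces.
  have key : ∀ t j : ℕ, t + j = k + 1 →
      HasIntervalPartition G (vertexRun n a (a + k) ∪ vertexRun n (a + k + j) b) (d + 1) := by
    intro t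
    induction t with
    | zero =>
      intro j hj
      have := hsplit (a + k) (a + k + j) (by omega) (by omega) (by omega) (by omega) (by omega)
      convert this using 1
      rw [hd, add_comm]; congr 2; omega
    | succ t iht =>
      intro j hj
      refine .of_deletion (v := ⟨a + k + j, by omega⟩)
        (B := vertexRun n a (a + j) ∪ vertexRun n (a + 2 * k + 1 + j) b) (by simp; omega) ?_ ?_ ?_
      · intro w
        simp only [mem_union, mem_vertexRun, ne_eq, Fin.ext_iff]
        constructor
        · intro hw
          refine ⟨by omega, by omega, ?_⟩
          rw [hG' _ _ (by simp; omega) (by simp; omega) (by omega) (by omega)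
            (by intro h; rw [← h] at hw; simp at hw; omega)]
          simp only; omega
        · rintro ⟨h1, h2, h3⟩
          rw [hG' _ _ (by simp; omega) (by simp; omega) (by omega) (by omega)
            (by rw [ne_eq, Fin.ext_iff]; exact fun h => h2 h.symm)] at h3
          simp only at h3; omega
      · convert iht (j + 1) (by omega) using 1
        ext w; simp [Fin.ext_iff]; omega
      -- The link needs only `d`. For `j = 0` its left piece is empty and the right piece has the
      -- full inductive length. For `j > 0` the right piece is shorter by `j ≤ k`, which the 1 from
      -- the left piece compensates.
      · rcases Nat.eq_zero_or_pos j with rfl | hj0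
        · convert hsub (a + 2 * k + 1) b (by omega) le_rfl (by omega) using 1
          · ext w; simp
          · rw [hd]; congr 1; omega
        · rcases le_or_gt (a + 2 * k + 1 + j) b with hjb | hjb
          · refine (hsplit (a + j) (a + 2 * k + 1 + j) (by omega) (by omega) hjb (by omega)
              (by omega)).mono ?_
            rw [hd, add_comm 1, ← Nat.add_div_right _ hD]
            exact Nat.div_le_div_right (by omega)
          · refine HasIntervalPartition.mono (.one G ⟨⟨a, by omega⟩, by simp; omega⟩) ?_
            rw [hd]
            exact Nat.lt_succ_iff.1 ((Nat.div_lt_iff_lt_mul hD).2 (by omega))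
  convert key (k + 1) 0 rfl using 1
  ext w; simp; omega

/-- Interval partitions for powers of cycles. -/
theorem hasIntervalPartition_cycle {G : SimpleGraph (Fin n)} {k : ℕ} (hk : 1 ≤ k)
    (hn : 2 * k + 2 ≤ n)
    (hG : ∀ i j : Fin n, i < j → (G.Adj i j ↔ j.1 ≤ i.1 + k ∨ n ≤ j.1 - i.1 + k)) :
    HasIntervalPartition G univ ((n - k + 2 * k) / (2 * k + 1)) := by
  have hD : 0 < 2 * k + 1 := by omega
  -- In a run of at most `n - k` vertices no edge wraps around, so it is a power of a path.
  have hrun : ∀ a b : ℕ, b ≤ n → b - a ≤ n - k →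
      HasIntervalPartition G (vertexRun n a b) ((b - a + 2 * k) / (2 * k + 1)) := by
    intro a b h1 h2
    refine hasIntervalPartition_vertexRun hk a b h1 fun i j hi hij hj => ?_
    rw [hG i j hij]; have : i.1 < j.1 := hij; omega
  obtain ⟨d, hd⟩ : ∃ d, d = (n - k - (2 * k + 1) + 2 * k) / (2 * k + 1) := ⟨_, rfl⟩
  by_cases hn' : 3 * k + 1 ≤ n
  swap
  · refine HasIntervalPartition.mono (.one G ⟨⟨0, by omega⟩, by simp⟩) ?_
    exact Nat.lt_succ_iff.1 ((Nat.div_lt_iff_lt_mul hD).2 (by omega))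
  have hd' : (n - k + 2 * k) / (2 * k + 1) = d + 1 := by
    rw [hd, ← Nat.add_div_right _ hD]; congr 1; omega
  -- The last `k` vertices are deleted from the top down. Each link is a run of `n - 2k - 1`
  -- vertices, at least the `n - 3k - 1` needed for `d`.
  have key : ∀ t j : ℕ, t + j = k → HasIntervalPartition G (vertexRun n 0 (n - j)) (d + 1) := by
    intro t
    induction t with
    | zero =>
      intro j hj
      rw [← hd']
      convert hrun 0 (n - j) (by omega) (by omega) using 2
      omega
    | succ t iht =>
      intro j hj
      refine .of_deletion (v := ⟨n - j - 1, by omega⟩)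
        (B := vertexRun n (k - j) (n - j - 1 - k)) (by simp; omega) ?_ ?_ ?_
      · intro w
        simp only [mem_vertexRun, ne_eq, Fin.ext_iff]
        have key : w.1 < n - j - 1 → (G.Adj ⟨n - j - 1, by omega⟩ w ↔
            n - j - 1 ≤ w.1 + k ∨ n ≤ (n - j - 1) - w.1 + k) := fun h => by
          rw [G.adj_comm, hG w _ h]
        constructor
        · intro hw
          refine ⟨by omega, by omega, ?_⟩
          rw [key (by omega)]; omega
        · rintro ⟨h1, h2, h3⟩
          rw [key (by omega)] at h3; omega
      · convert iht (j + 1) (by omega) using 1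
        ext w; simp [Fin.ext_iff]; omega
      · refine (hrun (k - j) (n - j - 1 - k) (by omega) (by omega)).mono ?_
        rw [hd]
        exact Nat.div_le_div_right (by omega)
  rw [hd']
  convert key k 0 rfl using 1
  ext w; simp

/-! ### Adjacency in powers of the cycle -/

theorem cycleGraph_adj_iff_dvd (hn : 3 ≤ n) {u v : Fin n} :
    (SimpleGraph.cycleGraph n).Adj u v ↔
      (n : ℤ) ∣ (v : ℤ) - u - 1 ∨ (n : ℤ) ∣ (v : ℤ) - u + 1 := by
  have key : ∀ u v : Fin n, (u - v).1 = 1 ↔ (n : ℤ) ∣ (u : ℤ) - v - 1 := by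
    intro u v
    have hu := u.2
    have hv := v.2
    rw [Fin.sub_def]
    simp only
    constructor
    · intro h
      have h1 := Nat.div_add_mod (n - v.1 + u.1) n
      rw [h] at h1
      refine ⟨((n - v.1 + u.1) / n : ℕ) - 1, ?_⟩
      have h2 : ((n * ((n - v.1 + u.1) / n) + 1 : ℕ) : ℤ) = ((n - v.1 + u.1 : ℕ) : ℤ) := by rw [h1]
      rw [Nat.cast_add, Nat.cast_mul, Nat.cast_add, Nat.cast_sub hv.le] at h2
      push_cast at h2 ⊢
      linarith
    · rintro ⟨c, hc⟩
      have hc1 : c < 1 := by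
        by_contra h
        have : (n : ℤ) * 1 ≤ n * c := by gcongr; omega
        omega
      have hc2 : -2 < c := by
        by_contra h
        have : (n : ℤ) * c ≤ n * (-2) := by gcongr; omega
        omega
      obtain rfl | rfl : c = 0 ∨ c = -1 := by omega
      · rw [show n - v.1 + u.1 = 1 + n by omega, Nat.add_mod_right, Nat.mod_eq_of_lt (by omega)]
      · rw [show n - v.1 + u.1 = 1 by omega, Nat.mod_eq_of_lt (by omega)]
  rw [SimpleGraph.cycleGraph_adj', key, key, or_comm]
  refine or_congr Iff.rfl ?_
  rw [← dvd_neg]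
  ring_nf

/-- Each step is `±1` modulo `n`; `t` is the net signed displacement. -/
theorem exists_dvd_of_walk_cycleGraph (hn : 3 ≤ n) {u v : Fin n}
    (p : (SimpleGraph.cycleGraph n).Walk u v) :
    ∃ t : ℤ, |t| ≤ p.length ∧ (n : ℤ) ∣ (v : ℤ) - u - t := by
  induction p with
  | nil => exact ⟨0, by simp⟩
  | @cons a b c h p ih =>
    obtain ⟨t, ht, hd⟩ := ih
    rw [SimpleGraph.Walk.length_cons]
    push_cast
    rcases (cycleGraph_adj_iff_dvd hn).1 h with h | h
    · refine ⟨t + 1, (abs_add_le _ _).trans (by simpa using ht), ?_⟩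
      rw [show (c : ℤ) - a - (t + 1) = (c - b - t) + (b - a - 1) by ring]
      exact dvd_add hd h
    · refine ⟨t - 1, (abs_sub _ _).trans (by simpa using ht), ?_⟩
      rw [show (c : ℤ) - a - (t - 1) = (c - b - t) + (b - a + 1) by ring]
      exact dvd_add hd h

theorem edist_cycleGraph_le (hn : 3 ≤ n) (m : ℕ) (u v : Fin n)
    (h : (n : ℤ) ∣ (v : ℤ) - u - m) : (SimpleGraph.cycleGraph n).edist u v ≤ m := by
  induction m generalizing v with
  | zero =>
    obtain rfl : u = v := by
      have := Int.eq_zero_of_abs_lt_dvd h (by rw [abs_lt]; omega)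
      omega
    simp
  | succ m ih =>
    obtain ⟨w, hw⟩ : ∃ w : Fin n, (n : ℤ) ∣ (v : ℤ) - w - 1 := by
      rcases Nat.eq_zero_or_pos v.1 with h0 | h0
      · exact ⟨⟨n - 1, by omega⟩, -1, by simp only; omega⟩
      · exact ⟨⟨v - 1, by omega⟩, 0, by simp only; omega⟩
    have h1 := ih w (by
      rw [show (w : ℤ) - u - m = (v - u - (m + 1 : ℕ)) - (v - w - 1) by push_cast; ring]
      exact dvd_sub h hw)
    have h2 : (SimpleGraph.cycleGraph n).edist w v ≤ 1 :=
      (SimpleGraph.edist_eq_one_iff_adj.2 ((cycleGraph_adj_iff_dvd hn).2 (Or.inl hw))).le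
    exact SimpleGraph.edist_triangle.trans (by push_cast; exact add_le_add h1 h2)

theorem cycleGraph_kthPower_adj (hn : 3 ≤ n) (k : ℕ) {i j : Fin n} (hij : i < j) :
    ((SimpleGraph.cycleGraph n).kthPower k).Adj i j ↔ j.1 ≤ i.1 + k ∨ n ≤ j.1 - i.1 + k := by
  have hlt : i.1 < j.1 := hij
  have hj := j.2
  have hne : i ≠ j := hij.ne
  constructor
  · rintro ⟨-, h⟩
    obtain ⟨p, hp⟩ := SimpleGraph.exists_walk_of_edist_ne_top
      (h.trans_lt (ENat.natCast_lt_top k)).ne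
    rw [← hp, Nat.cast_le] at h
    obtain ⟨t, ht, c, hc⟩ := exists_dvd_of_walk_cycleGraph hn p
    rw [abs_le] at ht
    -- The sign of `c` tells which of the two arcs between `i` and `j` is short.
    by_contra hcon
    push Not at hcon
    rcases lt_or_ge 0 c with h0 | h0
    · have : (n : ℤ) * 1 ≤ n * c := by gcongr; omega
      omega
    · have : (n : ℤ) * c ≤ n * 0 := by gcongr
      omega
  · rintro (h | h)
    · refine ⟨hne, (edist_cycleGraph_le hn (j - i) i j ⟨0, by omega⟩).trans ?_⟩
      exact_mod_cast (by omega : j.1 - i.1 ≤ k)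
    · refine ⟨hne, ?_⟩
      rw [SimpleGraph.edist_comm]
      refine (edist_cycleGraph_le hn (n - (j.1 - i.1)) j i ⟨-1, by omega⟩).trans ?_
      exact_mod_cast (by omega : n - (j.1 - i.1) ≤ k)

/-! ### Upper bound: a small maximal independent set -/

/-- A small maximal independent set in the power of a cycle. -/
theorem exists_maximal_isIndepSet_cycle {G : SimpleGraph (Fin n)} {k m : ℕ}
    (hn : 2 * k + 2 ≤ n) (hm : m * (2 * k + 1) < n) (hm' : n ≤ (m + 1) * (2 * k + 1))
    (hG : ∀ i j : Fin n, i < j → (G.Adj i j ↔ j.1 ≤ i.1 + k ∨ n ≤ j.1 - i.1 + k)) :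
    ∃ F : Finset (Fin n), G.IsIndepSet (F : Set (Fin n)) ∧ #F ≤ m + 1 ∧
      ∀ T : Finset (Fin n), G.IsIndepSet (T : Set (Fin n)) → F ⊆ T → T = F := by
  classical
  have hm0 : m ≠ 0 := by rintro rfl; omega
  -- The last multiple `m(2k+1)` may be adjacent to `0` around the cycle; capping it at `n - k - 1`
  -- prevents this, and `l` still lies more than `k` beyond the preceding multiple.
  obtain ⟨l, hl⟩ : ∃ l, l = min (m * (2 * k + 1)) (n - k - 1) := ⟨_, rfl⟩
  obtain ⟨m, rfl⟩ := Nat.exists_eq_succ_of_ne_zero hm0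
  let S : Finset ℕ := insert l ((range (m + 1)).image fun i => i * (2 * k + 1))
  let F : Finset (Fin n) := univ.filter fun v => v.1 ∈ S
  have hF : ∀ v : Fin n, v ∈ F ↔ v.1 = l ∨ ∃ q ≤ m, q * (2 * k + 1) = v.1 := by
    intro v; simp [F, S]
  have hle : ∀ q ≤ m, q * (2 * k + 1) ≤ m * (2 * k + 1) := fun q hq => Nat.mul_le_mul_right _ hq
  rw [Nat.succ_eq_add_one, Nat.add_mul] at hm hl
  rw [Nat.succ_eq_add_one, Nat.add_mul, Nat.add_mul] at hm'
  refine ⟨F, ?_, ?_, ?_⟩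
  · have key : ∀ u ∈ F, ∀ v ∈ F, u < v → ¬ G.Adj u v := by
      intro u hu v hv huv
      rw [hG u v huv]
      have huv' : u.1 < v.1 := huv
      have hvn := v.2
      rcases (hF u).1 hu with hu | ⟨q, hq, hu⟩ <;> rcases (hF v).1 hv with hv | ⟨q', hq', hv⟩
      · omega
      · have := hle q' hq'; omega
      · have := hle q hq; omega
      · have := hle q' hq'
        have : q < q' := by
          by_contra h
          have : q' * (2 * k + 1) ≤ q * (2 * k + 1) := Nat.mul_le_mul_right _ (not_lt.1 h)
          omega
        have : (q + 1) * (2 * k + 1) ≤ q' * (2 * k + 1) := Nat.mul_le_mul_right _ this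
        rw [Nat.add_mul] at this
        omega
    intro u hu v hv hne
    rcases lt_or_gt_of_ne hne with h | h
    · exact key u hu v hv h
    · exact fun hadj => key v hv u hu h hadj.symm
  · calc #F = #(F.image Fin.val) := (card_image_of_injective _ Fin.val_injective).symm
      _ ≤ #S := card_le_card fun x hx => by
          obtain ⟨v, hv, rfl⟩ := mem_image.1 hx
          exact (mem_filter.1 hv).2
      _ ≤ #((range (m + 1)).image fun i => i * (2 * k + 1)) + 1 := card_insert_le _ _
      _ ≤ m.succ + 1 := by
          have := card_image_le (s := range (m + 1)) (f := fun i => i * (2 * k + 1))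
          rw [card_range] at this
          omega
  · intro T hT hFT
    refine (subset_antisymm hFT fun v hv => ?_).symm
    by_contra hvF
    have hadj : ∀ u ∈ F, ¬ G.Adj u v := fun u hu =>
      hT (hFT hu) hv (by rintro rfl; exact hvF hu)
    have hfar : ∀ u ∈ F, (u.1 < v.1 → u.1 + k < v.1 ∧ v.1 - u.1 + k < n) ∧
        (v.1 < u.1 → v.1 + k < u.1) := by
      intro u hu
      refine ⟨fun h => ?_, fun h => ?_⟩
      · have := hadj u hu
        rw [hG u v h] at this; omega
      · have := hadj u hu
        rw [G.adj_comm, hG v u h] at this; omega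
    have hvn := v.2
    have hvl : v.1 ≠ l := fun h => hvF ((hF v).2 (Or.inl h))
    have hl' := hfar ⟨l, by omega⟩ ((hF _).2 (Or.inl rfl))
    have h0 := hfar ⟨0, by omega⟩ ((hF _).2 (Or.inr ⟨0, Nat.zero_le _, by simp⟩))
    simp only at hl' h0
    have hv0 : 0 < v.1 := by
      by_contra h
      exact hvF ((hF v).2 (Or.inr ⟨0, Nat.zero_le _, by omega⟩))
    obtain ⟨q, hq⟩ : ∃ q, q = v.1 / (2 * k + 1) := ⟨_, rfl⟩
    have hq1 := Nat.div_add_mod v.1 (2 * k + 1)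
    have hq2 := Nat.mod_lt v.1 (show 0 < 2 * k + 1 by omega)
    rw [← hq, mul_comm] at hq1
    have hqv : ∀ q ≤ m, (hqn : q * (2 * k + 1) < n) → q * (2 * k + 1) ≠ v.1 ∧ _ := fun q hqm hqn =>
      ⟨fun h => hvF ((hF v).2 (Or.inr ⟨q, hqm, h⟩)),
        hfar ⟨q * (2 * k + 1), hqn⟩ ((hF _).2 (Or.inr ⟨q, hqm, rfl⟩))⟩
    -- Cyclically consecutive elements of `F` are at most `2k+1` apart, so `v` is within `k` of one
    -- of them. The cases locate `v` between two multiples, in the block starting at the last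
    -- multiple, or beyond that block.
    rcases lt_trichotomy q m with h | h | h
    · have e1 := hqv q h.le (by have := hle q h.le; omega)
      have e2 := hqv (q + 1) h (by have := hle _ h; simp only [Nat.succ_eq_add_one] at this; omega)
      simp only [Nat.add_mul] at e1 e2
      omega
    · have e1 := hqv q h.le (by have := hle q h.le; omega)
      simp only at e1
      subst h
      omega
    · have : (m + 1) * (2 * k + 1) ≤ q * (2 * k + 1) := Nat.mul_le_mul_right _ h
      rw [Nat.add_mul] at this
      omega

/-! ### Stanley decompositions and independent sets -/

section EdgeIdealStanley

variable {K : Type*} [Field K] {G : SimpleGraph (Fin n)}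

open MvPolynomial

theorem mem_edgeIdeal_iff {p : MvPolynomial (Fin n) K} :
    p ∈ edgeIdeal K G ↔ ∀ a ∈ p.support, ¬ G.IsIndepSet (a.support : Set (Fin n)) := by
  have h : edgeIdeal K G = Ideal.span ((fun s => monomial s (1 : K)) ''
      {s | ∃ i j, G.Adj i j ∧ s = Finsupp.single i 1 + Finsupp.single j 1}) := by
    unfold edgeIdeal
    congr 1
    ext p
    simp only [Set.mem_ofPred_eq, Set.mem_image]
    constructor
    · rintro ⟨i, j, h, rfl⟩
      exact ⟨_, ⟨i, j, h, rfl⟩, by simp [X, monomial_mul]⟩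
    · rintro ⟨_, ⟨i, j, h, rfl⟩, rfl⟩
      exact ⟨i, j, h, by simp [X, monomial_mul]⟩
  rw [h, mem_ideal_span_monomial_image]
  refine forall₂_congr fun a _ => ?_
  constructor
  · rintro ⟨_, ⟨i, j, hij, rfl⟩, hle⟩ hi
    have hne : i ≠ j := hij.ne
    refine hi (x := i) (y := j) ?_ ?_ hne hij
    · have := hle i; simp [hne] at this ⊢; omega
    · have := hle j; simp [hne.symm] at this ⊢; omega
  · intro hi
    simp only [SimpleGraph.IsIndepSet, Set.Pairwise, not_forall, not_not] at hi
    obtain ⟨i, hi, j, hj, hne, hij⟩ := hi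
    simp at hi hj
    refine ⟨_, ⟨i, j, hij, rfl⟩, fun x => ?_⟩
    simp only [Finsupp.add_apply, Finsupp.single_apply]
    split_ifs with h1 h2 h2
    · exact absurd (h1.trans h2.symm) hne
    · subst h1; omega
    · subst h2; omega
    · simp

theorem mk_monomial_eq_zero_iff {a : Fin n →₀ ℕ} {c : K} (hc : c ≠ 0) :
    Ideal.Quotient.mk (edgeIdeal K G) (monomial a c) = 0 ↔
      ¬ G.IsIndepSet (a.support : Set (Fin n)) := by
  classical
  rw [Ideal.Quotient.eq_zero_iff_mem, mem_edgeIdeal_iff, support_monomial, if_neg hc]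
  simp

/-- The exponents of the monomials that are nonzero in the quotient by the edge ideal. -/
abbrev IndepExponent (G : SimpleGraph (Fin n)) : Type :=
  {a : Fin n →₀ ℕ // G.IsIndepSet (a.support : Set (Fin n))}

/-- The class of a monomial in the quotient by the edge ideal. -/
noncomputable def standardMonomial (K : Type*) [Field K] (G : SimpleGraph (Fin n))
    (a : IndepExponent G) : MvPolynomial (Fin n) K ⧸ edgeIdeal K G :=
  Ideal.Quotient.mk _ (monomial a.1 1)

/-- The coefficient of a monomial outside the edge ideal is well defined on the quotient. -/
noncomputable def standardCoeff (K : Type*) [Field K] (G : SimpleGraph (Fin n))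
    (a : IndepExponent G) : (MvPolynomial (Fin n) K ⧸ edgeIdeal K G) →ₗ[K] K :=
  Submodule.liftQ ((edgeIdeal K G).restrictScalars K) (lcoeff K a.1) fun p hp => by
    by_contra h
    exact mem_edgeIdeal_iff.1 hp a.1 (mem_support_iff.2 h) a.2

theorem standardCoeff_mk (a : IndepExponent G) (p : MvPolynomial (Fin n) K) :
    standardCoeff K G a (Ideal.Quotient.mk _ p) = coeff a.1 p := rfl

theorem linearIndependent_standardMonomial :
    LinearIndependent K (standardMonomial K G) := by
  classical
  rw [linearIndependent_iff']
  intro s g h a ha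
  have := congrArg (standardCoeff K G a) h
  simp only [map_sum, map_smul, standardMonomial, standardCoeff_mk, coeff_monomial, map_zero,
    Subtype.val_inj] at this
  simpa [ha] using this

theorem span_range_standardMonomial :
    Submodule.span K (Set.range (standardMonomial K G)) = ⊤ := by
  rw [eq_top_iff]
  rintro x -
  obtain ⟨p, rfl⟩ := Ideal.Quotient.mk_surjective x
  rw [p.as_sum, map_sum]
  refine Submodule.sum_mem _ fun a _ => ?_
  by_cases ha : G.IsIndepSet (a.support : Set (Fin n))
  · have : Ideal.Quotient.mk (edgeIdeal K G) (monomial a (coeff a p)) =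
        coeff a p • standardMonomial K G ⟨a, ha⟩ := by
      rw [standardMonomial, ← Ideal.Quotient.mkₐ_eq_mk K, ← map_smul, smul_monomial, smul_eq_mul,
        mul_one]
    rw [this]
    exact Submodule.smul_mem _ _ (Submodule.subset_span ⟨_, rfl⟩)
  · by_cases hc : coeff a p = 0
    · simp [hc]
    · rw [(mk_monomial_eq_zero_iff hc).2 ha]
      exact Submodule.zero_mem _

/-- The exponent of the squarefree monomial with the given support. -/
noncomputable def squarefreeExponent (F : Finset (Fin n)) : Fin n →₀ ℕ :=
  Finsupp.indicator F fun _ _ => 1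

theorem squarefreeExponent_apply [DecidableEq (Fin n)] (F : Finset (Fin n)) (i : Fin n) :
    squarefreeExponent F i = if i ∈ F then 1 else 0 := by
  simp [squarefreeExponent, Finsupp.indicator_apply]

@[simp] theorem support_squarefreeExponent (F : Finset (Fin n)) :
    (squarefreeExponent F).support = F := by
  classical
  ext i; simp [squarefreeExponent_apply]

theorem support_add_nat (a b : Fin n →₀ ℕ) : (a + b).support = a.support ∪ b.support := by
  ext i; simp; omega

theorem monomial_smul_mk (I : Ideal (MvPolynomial (Fin n) K)) (a b : Fin n →₀ ℕ) (c d : K) :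
    (monomial a c : MvPolynomial (Fin n) K) • Ideal.Quotient.mk I (monomial b d) =
      Ideal.Quotient.mk I (monomial (a + b) (c * d)) := by
  rw [← monomial_mul, map_mul]; rfl

/-- Multiplying by `x_F` forces positive exponents on `F` and leaves the others on `T` free; this is
the dictionary from intervals to Stanley spaces. -/
theorem stanleySubspace_squarefree {F T : Finset (Fin n)} (hFT : F ⊆ T)
    (hT : G.IsIndepSet (T : Set (Fin n))) :
    stanleySubspace (edgeIdeal K G) (Ideal.Quotient.mk _ (monomial (squarefreeExponent F) 1)) T =
      Submodule.span K (standardMonomial K G '' {a | F ⊆ a.1.support ∧ a.1.support ⊆ T}) := by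
  classical
  unfold stanleySubspace
  congr 1
  ext y
  simp only [Set.mem_ofPred_eq, Set.mem_image, monomial_smul_mk, mul_one]
  constructor
  · rintro ⟨a, ha, rfl⟩
    have h : (a + squarefreeExponent F).support ⊆ T := by
      rw [support_add_nat, support_squarefreeExponent]
      exact union_subset ha hFT
    refine ⟨⟨a + squarefreeExponent F, hT.mono (by exact_mod_cast h)⟩, ⟨?_, h⟩, rfl⟩
    rw [support_add_nat, support_squarefreeExponent]
    exact subset_union_right
  · rintro ⟨⟨b, hb⟩, ⟨h1, h2⟩, rfl⟩
    refine ⟨b - squarefreeExponent F, fun i hi => h2 ?_, ?_⟩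
    · simp at hi ⊢; omega
    · rw [tsub_add_cancel_of_le]
      · rfl
      · intro i
        rw [squarefreeExponent_apply]
        split_ifs with h
        · have := h1 h; simp at this; omega
        · simp

theorem mk_monomial_free {F T : Finset (Fin n)} (hFT : F ⊆ T)
    (hT : G.IsIndepSet (T : Set (Fin n))) (p : MvPolynomial (Fin n) K)
    (hp : p ∈ supported K (T : Set (Fin n)))
    (h : p • Ideal.Quotient.mk (edgeIdeal K G) (monomial (squarefreeExponent F) 1) = 0) :
    p = 0 := by
  classical
  by_contra hp0
  obtain ⟨a, ha⟩ := support_nonempty.2 hp0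
  have h' : p * monomial (squarefreeExponent F) 1 ∈ edgeIdeal K G := by
    rw [← Ideal.Quotient.eq_zero_iff_mem, map_mul]; exact h
  refine mem_edgeIdeal_iff.1 h' (a + squarefreeExponent F) ?_ (hT.mono ?_)
  · rw [mem_support_iff, coeff_mul_monomial, mul_one]
    exact mem_support_iff.1 ha
  · rw [support_add_nat, support_squarefreeExponent]
    have : a.support ⊆ T := by
      intro i hi
      have := mem_supported.1 hp (mem_vars_iff_mem_support i |>.2 ⟨a, ha, hi⟩)
      exact_mod_cast this
    exact_mod_cast union_subset this hFT

theorem exists_stanleyDecomposition {d : ℕ} (h : HasIntervalPartition G univ d) :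
    ∃ D : StanleyDecomposition (edgeIdeal K G), d ≤ D.sdepth := by
  classical
  obtain ⟨P, hP, hP'⟩ := h
  let e := P.equivFin.symm
  have hmem : ∀ i, (e i).1 ∈ P := fun i => (e i).2
  let M : Fin #P → Set (IndepExponent G) := fun i =>
    {a | (e i).1.1 ⊆ a.1.support ∧ a.1.support ⊆ (e i).1.2}
  have hspan : ∀ i, stanleySubspace (edgeIdeal K G)
      (Ideal.Quotient.mk _ (monomial (squarefreeExponent (e i).1.1) 1)) (e i).1.2 =
      Submodule.span K (standardMonomial K G '' M i) := fun i =>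
    stanleySubspace_squarefree (hP _ (hmem i)).1 (hP _ (hmem i)).2.2.1
  refine ⟨⟨#P, fun i => Ideal.Quotient.mk _ (monomial (squarefreeExponent (e i).1.1) 1),
    fun i => (e i).1.2, fun i => ⟨_, _, rfl⟩,
    fun i => mk_monomial_free (hP _ (hmem i)).1 (hP _ (hmem i)).2.2.1, ?_⟩, ?_⟩
  · simp_rw [hspan]
    rw [DirectSum.isInternal_submodule_iff_iSupIndep_and_iSup_eq_top]
    constructor
    · intro i
      simp_rw [← Submodule.span_iUnion, ← Set.image_iUnion]
      refine linearIndependent_standardMonomial.disjoint_span_image ?_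
      rw [Set.disjoint_left]
      intro a ha ha'
      simp only [Set.mem_iUnion] at ha'
      obtain ⟨j, hj, ha'⟩ := ha'
      have hu := (hP' a.1.support (subset_univ _) a.2).unique
        ⟨hmem i, ha⟩ ⟨hmem j, ha'⟩
      exact hj (e.injective (Subtype.ext hu)).symm
    · rw [← Submodule.span_iUnion, ← Set.image_iUnion, ← span_range_standardMonomial (K := K) (G := G),
        ← Set.image_univ]
      congr 2
      rw [Set.eq_univ_iff_forall]
      intro a
      obtain ⟨p, ⟨hp, h1, h2⟩, -⟩ := hP' a.1.support (subset_univ _) a.2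
      refine Set.mem_iUnion.2 ⟨e.symm ⟨p, hp⟩, ?_⟩
      simpa [M] using ⟨h1, h2⟩
  -- The infimum over an empty family is 0, so a summand is needed; the interval containing `∅`
  -- supplies one.
  · obtain ⟨p, ⟨hp, -⟩, -⟩ := hP' ∅ (empty_subset _) (by simp [SimpleGraph.IsIndepSet])
    have : Nonempty (Fin #P) := ⟨e.symm ⟨p, hp⟩⟩
    exact le_ciInf fun i => (hP _ (hmem i)).2.2.2

theorem StanleyDecomposition.sdepth_le_card (D : StanleyDecomposition (edgeIdeal K G))
    {F : Finset (Fin n)} (hF : G.IsIndepSet (F : Set (Fin n)))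
    (hmax : ∀ T : Finset (Fin n), G.IsIndepSet (T : Set (Fin n)) → F ⊆ T → T = F) :
    D.sdepth ≤ #F := by
  classical
  choose a c hv using D.homogeneous
  let f : IndepExponent G := ⟨squarefreeExponent F, by simpa using hF⟩
  -- Some summand must produce `x_F`; otherwise the coefficient functional at `x_F` would vanish on
  -- every summand, hence everywhere.
  obtain ⟨i, b, hb, hab⟩ : ∃ i, ∃ b : Fin n →₀ ℕ, b.support ⊆ D.W i ∧
      b + a i = squarefreeExponent F := by
    by_contra! hcon
    have htop : ⨆ i, stanleySubspace (edgeIdeal K G) (D.v i) (D.W i) = ⊤ :=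
      D.isInternal.submodule_iSup_eq_top
    have hker : ⨆ i, stanleySubspace (edgeIdeal K G) (D.v i) (D.W i) ≤
        LinearMap.ker (standardCoeff K G f) := by
      refine iSup_le fun i => Submodule.span_le.2 ?_
      rintro _ ⟨b, hb, rfl⟩
      rw [SetLike.mem_coe, LinearMap.mem_ker, hv i, monomial_smul_mk, standardCoeff_mk,
        coeff_monomial, if_neg (hcon i b hb)]
    rw [htop] at hker
    have := LinearMap.mem_ker.1 (hker (Submodule.mem_top (x := standardMonomial K G f)))
    rw [standardMonomial, standardCoeff_mk, coeff_monomial, if_pos rfl] at this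
    exact one_ne_zero this
  -- Freeness, tested on the product of all variables in `W i`, says that this product times `v i`
  -- is nonzero.
  have hind : G.IsIndepSet ((D.W i ∪ (a i).support : Finset (Fin n)) : Set (Fin n)) := by
    by_contra hcon
    have h := D.free i (monomial (squarefreeExponent (D.W i)) 1) ?_ ?_
    · exact one_ne_zero (monomial_eq_zero.1 h)
    · rw [mem_supported, vars_monomial one_ne_zero, support_squarefreeExponent]
    · rw [hv i, monomial_smul_mk, one_mul]
      by_cases hc : c i = 0
      · simp [hc]
      · rw [mk_monomial_eq_zero_iff hc, support_add_nat, support_squarefreeExponent]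
        exact hcon
  have hsub : F ⊆ D.W i ∪ (a i).support := by
    rw [← support_squarefreeExponent F, ← hab, support_add_nat]
    exact union_subset_union hb subset_rfl
  have hW : D.W i ⊆ F := by
    rw [← hmax _ hind hsub]; exact subset_union_left
  exact (ciInf_le (OrderBot.bddBelow _) i).trans (card_le_card hW)

theorem le_stanleyDepth {d : ℕ} (h : HasIntervalPartition G univ d) :
    d ≤ stanleyDepth (edgeIdeal K G) := by
  obtain ⟨D, hD⟩ := exists_stanleyDecomposition (K := K) h
  refine hD.trans (le_csSup ⟨n, ?_⟩ ⟨D, rfl⟩)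
  rintro _ ⟨D, rfl⟩
  exact D.sdepth_le

theorem stanleyDepth_le_card {F : Finset (Fin n)} (hF : G.IsIndepSet (F : Set (Fin n)))
    (hmax : ∀ T : Finset (Fin n), G.IsIndepSet (T : Set (Fin n)) → F ⊆ T → T = F) :
    stanleyDepth (edgeIdeal K G) ≤ #F := by
  refine csSup_le' ?_
  rintro _ ⟨D, rfl⟩
  exact D.sdepth_le_card hF hmax

end EdgeIdealStanley

/-! ### Comparison of the two bounds -/

theorem corollary4p7 (K : Type*) [Field K] (n k : ℕ) (hn : 3 ≤ n) (hk : 1 ≤ k) :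
    (n ≤ 2 * k + 1 →
      stanleyDepth (edgeIdeal K ((SimpleGraph.cycleGraph n).kthPower k)) = 1) ∧
    (2 * k + 2 ≤ n →
      ((n % (2 * k + 1) = 0 ∨ k + 1 ≤ n % (2 * k + 1)) →
        (stanleyDepth (edgeIdeal K ((SimpleGraph.cycleGraph n).kthPower k)) : ℤ) =
          ⌈(n : ℚ) / (2 * (k : ℚ) + 1)⌉) ∧
      ((1 ≤ n % (2 * k + 1) ∧ n % (2 * k + 1) ≤ k) →
        ⌈(n : ℚ) / (2 * (k : ℚ) + 1)⌉ - 1 ≤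
            (stanleyDepth (edgeIdeal K ((SimpleGraph.cycleGraph n).kthPower k)) : ℤ) ∧
          (stanleyDepth (edgeIdeal K ((SimpleGraph.cycleGraph n).kthPower k)) : ℤ) ≤
            ⌈(n : ℚ) / (2 * (k : ℚ) + 1)⌉)) := by
  have hG : ∀ i j : Fin n, i < j → (((SimpleGraph.cycleGraph n).kthPower k).Adj i j ↔
      j.1 ≤ i.1 + k ∨ n ≤ j.1 - i.1 + k) := fun i j h => cycleGraph_kthPower_adj hn k h
  generalize (SimpleGraph.cycleGraph n).kthPower k = G at hG ⊢
  refine ⟨fun h => le_antisymm ?_ ?_, fun h => ?_⟩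
  · have hadj : ∀ i j : Fin n, i ≠ j → G.Adj i j := by
      have key : ∀ i j : Fin n, i < j → G.Adj i j := fun i j hij => (hG i j hij).2 (by omega)
      intro i j hij
      rcases lt_or_gt_of_ne hij with h | h
      · exact key i j h
      · exact (key j i h).symm
    let v : Fin n := ⟨0, by omega⟩
    refine (stanleyDepth_le_card (F := {v}) (by simp) fun T hT hvT => ?_).trans
      (Finset.card_singleton v).le
    refine (Finset.Subset.antisymm hvT fun w hw => ?_).symm
    by_contra hne
    rw [Finset.mem_singleton] at hne
    exact hT hw (Finset.singleton_subset_iff.1 hvT) hne (hadj w v hne)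
  · exact le_stanleyDepth (.one G ⟨⟨0, by omega⟩, Finset.mem_univ _⟩)
  have hD : 0 < 2 * k + 1 := by omega
  -- Chosen so that `m + 1 = ⌈n/(2k+1)⌉`.
  obtain ⟨m, hm⟩ : ∃ m, m = (n - 1) / (2 * k + 1) := ⟨_, rfl⟩
  have hm1 : m * (2 * k + 1) < n := by
    have := Nat.div_mul_le_self (n - 1) (2 * k + 1)
    rw [← hm] at this; omega
  have hm2 : n ≤ (m + 1) * (2 * k + 1) := by
    have := (Nat.div_lt_iff_lt_mul hD).1 (hm.symm.trans_lt (Nat.lt_succ_self m))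
    rw [Nat.succ_eq_add_one] at this; omega
  have hceil : ⌈(n : ℚ) / (2 * (k : ℚ) + 1)⌉ = (m : ℤ) + 1 := by
    have hDq : (0 : ℚ) < 2 * (k : ℚ) + 1 := by positivity
    rw [Int.ceil_eq_iff, lt_div_iff₀ hDq, div_le_iff₀ hDq]
    have h1 : ((m * (2 * k + 1) : ℕ) : ℚ) < n := by exact_mod_cast hm1
    have h2 : (n : ℚ) ≤ ((m + 1) * (2 * k + 1) : ℕ) := by exact_mod_cast hm2
    push_cast at h1 h2 ⊢
    constructor <;> linarith
  rw [hceil]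
  have hup : stanleyDepth (edgeIdeal K G) ≤ m + 1 := by
    obtain ⟨F, hF, hcard, hmax⟩ := exists_maximal_isIndepSet_cycle h hm1 hm2 hG
    exact (stanleyDepth_le_card hF hmax).trans hcard
  have hlow := le_stanleyDepth (K := K) (hasIntervalPartition_cycle hk h hG)
  have hnm := Nat.div_add_mod n (2 * k + 1)
  have hlt := Nat.mod_lt n hD
  obtain ⟨q, hq⟩ : ∃ q, q = n / (2 * k + 1) := ⟨_, rfl⟩
  rw [← hq, mul_comm] at hnm
  rw [Nat.add_mul] at hm2
  refine ⟨fun hr => ?_, fun hr => ⟨?_, by exact_mod_cast hup⟩⟩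
  -- For these residues, removing `k` vertices does not lower the ceiling.
  · have hle : m + 1 ≤ (n - k + 2 * k) / (2 * k + 1) := by
      rw [Nat.le_div_iff_mul_le hD, Nat.add_mul]
      rcases hr with hr | hr
      · have : m < q := Nat.lt_of_mul_lt_mul_right (a := 2 * k + 1) (by omega)
        have : (m + 1) * (2 * k + 1) ≤ q * (2 * k + 1) := Nat.mul_le_mul_right _ this
        rw [Nat.add_mul] at this
        omega
      · have : m ≤ q := by
          by_contra hcon
          have : (q + 1) * (2 * k + 1) ≤ m * (2 * k + 1) := Nat.mul_le_mul_right _ (by omega)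
          rw [Nat.add_mul] at this
          omega
        have : m * (2 * k + 1) ≤ q * (2 * k + 1) := Nat.mul_le_mul_right _ this
        omega
    exact_mod_cast le_antisymm hup (hle.trans hlow)
  · have hle : m ≤ (n - k + 2 * k) / (2 * k + 1) := by
      rw [Nat.le_div_iff_mul_le hD]
      omega
    have := hle.trans hlow
    omega
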